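/- Let $n$ and $N$ be the state dimension and the number of modes, let $A_1,\dots,A_N$ be real $n\times n$ matrices, and let $(\Omega,\mathcal M,P)$ be a probability space. For each initial mode $\sigma_0\in\{1,\dots,N\}$ (a constant) let $\{\sigma_k\}_{k\ge 0}$, $\{t_k\}_{k\ge 0}$, $\{J_k\}_{k\ge 0}$ be stochastic processes on $\Omega$, starting from this $\sigma_0$, with values in $\{1,\dots,N\}$, $[0,\infty)$ and $\mathbb R^{n\times n}$, such that $t_0=0$ and $t_0\le t_1\le t_2\le\cdots$; put $h_k=t_{k+1}-t_k$. Consider the switched system $$\Sigma:\quad \frac{dx}{dt}=A_{\sigma_k}x(t)\ \ (t_k\le t<t_{k+1}),\qquad x(t_{k+1})=J_k\,x(t_{k+1}^-)\ \ (k\ge 0),\qquad x(0)=x_0,$$ where $x_0\in\mathbb R^n$ is constant and the equations hold almost surely. Assume the following. 1. (Markov property) For all $k\ge0$, all modes $j$, all $t\ge 0$ and all Borel sets $B\subseteq\mathbb R^{n\times n}$, almost surely $$P(\sigma_{k+1}=j,\,h_k\le t,\,J_k\in B\mid \sigma_k,\dots,\sigma_0,t_k,\dots,t_0,J_{k-1},\dots,J_0)=P(\sigma_{k+1}=j,\,h_k\le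 t,\,J_k\in B\mid\sigma_k).$$ 2. (Time homogeneity) For all modes $i,j$, all $t\ge0$ and all Borel sets $B$, the probability $P(\sigma_{k+1}=j,\,h_k\le t,\,J_k\in B\mid\sigma_k=i)$, wherever it is defined (that is, where $P(\sigma_k=i)\neq0$), depends neither on $k$ nor on the initial mode $\sigma_0$. 3. (Positivity) The off-diagonal entries of $A_1,\dots,A_N$ are nonnegative, and for every $k$ all entries of $J_k$ are nonnegative almost surely. 4. For every $k\ge 0$, $h_k>0$ almost surely; there is $T>0$ such that $h_k\le T$ almost surely for every $k\ge0$; and there is $R>0$ such that $\|J_k\|\le R$ almost surely for every $k\ge0$. Let $\mathcal S\Sigma$ be the discrete-time system $$\mathcal S\Sigma:\quad x_d(k+1)=J_k\,e^{A_{\sigma_k}h_k}\,x_d(k)\ \ (k\ge0),\qquad x_d(0)=x_0,$$ let $m$ be a positive integer, and let $\|\cdot\|$ be the Euclidean norm on $\mathbb R^n$. (On matrices, $\|\cdot\|$ is the operator norm it induces.) Then the following are equivalent: * $\Sigma$ is exponentially $m$-th mean stable: there are $C>0$ and $\beta>0$ such that $E[\|x(t)\|^m]\le Ce^{-\beta t}\|x_0\|^m$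 for all $x_0\in\mathbb R^n$, all initial modes $\sigma_0$, all trajectories $x$ of $\Sigma$ with these initial data, and all real $t\ge0$; * $\mathcal S\Sigma$ is exponentially $m$-th mean stable: there are $C>0$ and $\beta>0$ such that $E[\|x_d(k)\|^m]\le Ce^{-\beta k}\|x_0\|^m$ for all $x_0\in\mathbb R^n$, all initial modes $\sigma_0$, and all integers $k\ge0$. (The expectations are of nonnegative random variables and may a priori be $+\infty$; the inequalities include their finiteness.) -/

import Mathlib

open MeasureTheory ProbabilityTheory Filter Topology Set
open scoped Matrix ENNReal

/-- Square real matrices carry the Borel σ-algebra (that of `ℝ^(n × n)`). -/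
instance matrixMeasurableSpace {n : ℕ} : MeasurableSpace (Matrix (Fin n) (Fin n) ℝ) :=
  inferInstanceAs (MeasurableSpace (Fin n → Fin n → ℝ))

instance matrixBorelSpace {n : ℕ} : BorelSpace (Matrix (Fin n) (Fin n) ℝ) :=
  inferInstanceAs (BorelSpace (Fin n → Fin n → ℝ))

noncomputable section

/-- The data of a continuous-time stochastic switched system with modes `Fin N` and state space
`ℝⁿ`, on the sample space `Ω`. The initial mode is a constant that the stability notions range
over, so there is one triple of processes for every initial mode `i`. -/
structure SwitchedSystem (N n : ℕ) (Ω : Type*) [MeasurableSpace Ω] where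
  /-- the matrices of the subsystems -/
  A : Fin N → Matrix (Fin n) (Fin n) ℝ
  /-- `mode i k` is the `k`-th mode, when the initial mode is `i` -/
  mode : Fin N → ℕ → Ω → Fin N
  /-- `time i k` is the `k`-th switching time, when the initial mode is `i` -/
  time : Fin N → ℕ → Ω → ℝ
  /-- `J i k` is the `k`-th jump matrix, when the initial mode is `i` -/
  J : Fin N → ℕ → Ω → Matrix (Fin n) (Fin n) ℝ
  measurable_mode : ∀ i k, Measurable (mode i k)
  measurable_time : ∀ i k, Measurable (time i k)
  measurable_J : ∀ i k, Measurable (J i k)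
  mode_zero : ∀ i ω, mode i 0 ω = i
  time_zero : ∀ i ω, time i 0 ω = 0
  time_mono : ∀ i ω, Monotone fun k => time i k ω

namespace SwitchedSystem

variable {N n : ℕ} {Ω : Type*} [MeasurableSpace Ω] (S : SwitchedSystem N n Ω)

/-- The dwell times `h_k = t_{k+1} - t_k`. -/
def dwell (i : Fin N) (k : ℕ) (ω : Ω) : ℝ :=
  S.time i (k + 1) ω - S.time i k ω

/-- The event `{σ_{k+1} = j, h_k ≤ s, J_k ∈ B}`, for the initial mode `i`. -/
def jumpEvent (i : Fin N) (k : ℕ) (j : Fin N) (s : ℝ) (B : Set (Matrix (Fin n) (Fin n) ℝ)) :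
    Set Ω :=
  {ω | S.mode i (k + 1) ω = j ∧ S.dwell i k ω ≤ s ∧ S.J i k ω ∈ B}

/-- The σ-algebra generated by `σ_0, …, σ_k`, `t_0, …, t_k`, `J_0, …, J_{k-1}`. -/
@[reducible] def history (i : Fin N) (k : ℕ) : MeasurableSpace Ω :=
  (⨆ l ≤ k, MeasurableSpace.comap (S.mode i l) inferInstance) ⊔
    (⨆ l ≤ k, MeasurableSpace.comap (S.time i l) inferInstance) ⊔
      (⨆ l < k, MeasurableSpace.comap (S.J i l) inferInstance)

/-- Continuous-time semi-Markovian jump linear systems. -/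
structure IsSemiMarkov (P : Measure Ω) : Prop where
  /-- Markov property: conditioning on the whole past is conditioning on `σ_k`. -/
  markov : ∀ (i : Fin N) (k : ℕ) (j : Fin N) (s : ℝ) (B : Set (Matrix (Fin n) (Fin n) ℝ)),
    0 ≤ s → MeasurableSet B →
      P⟦S.jumpEvent i k j s B | S.history i k⟧ =ᵐ[P]
        P⟦S.jumpEvent i k j s B | MeasurableSpace.comap (S.mode i k) inferInstance⟧
  /-- Time homogeneity: wherever it is defined, the transition probability
  `P(σ_{k+1} = j, h_k ≤ s, J_k ∈ B | σ_k = l)` depends neither on `k` nor on the initial mode. -/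
  homogeneous : ∀ (i i' : Fin N) (k k' : ℕ) (l j : Fin N) (s : ℝ)
    (B : Set (Matrix (Fin n) (Fin n) ℝ)), 0 ≤ s → MeasurableSet B →
      P (S.mode i k ⁻¹' {l}) ≠ 0 → P (S.mode i' k' ⁻¹' {l}) ≠ 0 →
        P[|S.mode i k ⁻¹' {l}] (S.jumpEvent i k j s B) =
          P[|S.mode i' k' ⁻¹' {l}] (S.jumpEvent i' k' j s B)

/-- Positivity: each `A i` is Metzler, and every jump matrix is nonnegative almost surely. -/
structure IsPositive (P : Measure Ω) : Prop where
  metzler : ∀ (i : Fin N) (a b : Fin n), a ≠ b → 0 ≤ S.A i a b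
  jump_nonneg : ∀ (i : Fin N) (k : ℕ), ∀ᵐ ω ∂P, ∀ a b, 0 ≤ S.J i k ω a b

/-- Positive dwell times, uniformly bounded dwell times, uniformly bounded jump matrices
(in the operator norm induced by the Euclidean norm), all almost surely. -/
structure IsBounded (P : Measure Ω) : Prop where
  dwell_pos : ∀ (i : Fin N) (k : ℕ), ∀ᵐ ω ∂P, 0 < S.dwell i k ω
  dwell_le : ∃ T : ℝ, 0 < T ∧ ∀ (i : Fin N) (k : ℕ), ∀ᵐ ω ∂P, S.dwell i k ω ≤ T
  jump_le : ∃ R : ℝ, 0 < R ∧ ∀ (i : Fin N) (k : ℕ), ∀ᵐ ω ∂P,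
    ‖Matrix.toEuclideanCLM (𝕜 := ℝ) (S.J i k ω)‖ ≤ R

/-- `x` is a trajectory with initial mode `i` and initial state `x₀`: almost surely `x(0) = x₀`,
`x' = A_{σ_k} x` on `[t_k, t_{k+1})` (one-sided at `t_k`) and `x(t_{k+1}) = J_k x(t_{k+1}⁻)`. -/
structure IsTrajectory (P : Measure Ω) (i : Fin N) (x₀ : EuclideanSpace ℝ (Fin n))
    (x : ℝ → Ω → EuclideanSpace ℝ (Fin n)) : Prop where
  initial : ∀ᵐ ω ∂P, x 0 ω = x₀
  flow : ∀ᵐ ω ∂P, ∀ k : ℕ, ∀ t ∈ Ico (S.time i k ω) (S.time i (k + 1) ω),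
    HasDerivWithinAt (fun s => x s ω)
      (Matrix.toEuclideanCLM (𝕜 := ℝ) (S.A (S.mode i k ω)) (x t ω))
      (Ico (S.time i k ω) (S.time i (k + 1) ω)) t
  jump : ∀ᵐ ω ∂P, ∀ k : ℕ, ∃ y : EuclideanSpace ℝ (Fin n),
    Tendsto (fun s => x s ω) (𝓝[<] S.time i (k + 1) ω) (𝓝 y) ∧
      x (S.time i (k + 1) ω) ω = Matrix.toEuclideanCLM (𝕜 := ℝ) (S.J i k ω) y

/-- Exponential `m`-th mean stability: `E‖x(t)‖^m ≤ C e^{-β t} ‖x₀‖^m` with `C`, `β` independent of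
the initial mode, the initial state and `t`. The expectation is a lower Lebesgue integral, so that
the bound includes its finiteness. -/
def IsExpMeanStable (P : Measure Ω) (m : ℕ) : Prop :=
  ∃ C > (0 : ℝ), ∃ β > (0 : ℝ), ∀ (i : Fin N) (x₀ : EuclideanSpace ℝ (Fin n))
    (x : ℝ → Ω → EuclideanSpace ℝ (Fin n)), S.IsTrajectory P i x₀ x →
      ∀ t : ℝ, 0 ≤ t →
        ∫⁻ ω, ‖x t ω‖ₑ ^ m ∂P ≤ ENNReal.ofReal (C * Real.exp (-β * t) * ‖x₀‖ ^ m)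

end SwitchedSystem

/-- A discrete-time switched linear system `x(k+1) = F_k x(k)`, with one pair of processes
`σ`, `F` for every initial mode. -/
structure DiscreteSwitchedSystem (N n : ℕ) (Ω : Type*) where
  mode : Fin N → ℕ → Ω → Fin N
  F : Fin N → ℕ → Ω → Matrix (Fin n) (Fin n) ℝ
  mode_zero : ∀ i ω, mode i 0 ω = i

namespace DiscreteSwitchedSystem

variable {N n : ℕ} {Ω : Type*} [MeasurableSpace Ω] (D : DiscreteSwitchedSystem N n Ω)

/-- The solution of `x(k+1) = F_k x(k)`, `x(0) = x₀`, with initial mode `i`. -/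
def trajectory (i : Fin N) (x₀ : EuclideanSpace ℝ (Fin n)) : ℕ → Ω → EuclideanSpace ℝ (Fin n)
  | 0, _ => x₀
  | k + 1, ω => Matrix.toEuclideanCLM (𝕜 := ℝ) (D.F i k ω) (trajectory i x₀ k ω)

/-- Exponential `m`-th mean stability in discrete time. -/
def IsExpMeanStable (P : Measure Ω) (m : ℕ) : Prop :=
  ∃ C > (0 : ℝ), ∃ β > (0 : ℝ), ∀ (i : Fin N) (x₀ : EuclideanSpace ℝ (Fin n)) (k : ℕ),
    ∫⁻ ω, ‖D.trajectory i x₀ k ω‖ₑ ^ m ∂P ≤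
      ENNReal.ofReal (C * Real.exp (-β * k) * ‖x₀‖ ^ m)

end DiscreteSwitchedSystem

/-- The discretization `x_d(k+1) = J_k e^{A_{σ_k} h_k} x_d(k)`. -/
def SwitchedSystem.discretization {N n : ℕ} {Ω : Type*} [MeasurableSpace Ω]
    (S : SwitchedSystem N n Ω) : DiscreteSwitchedSystem N n Ω where
  mode := S.mode
  F := fun i k ω => S.J i k ω * NormedSpace.exp (S.dwell i k ω • S.A (S.mode i k ω))
  mode_zero := S.mode_zero

end

noncomputable section

namespace SwitchedSystem

/-! Both directions compare `x` with `x_d` inside a switching interval. Dwell times are at most `T`,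
so the flow there changes norms by at most a factor `M`, in both directions
(`IsBounded.exists_flow_bounds`).

Discrete to continuous: almost surely the switching times pass every `t` (`ae_exists_lt_time`), and
`t` can lie in interval `k` only if `t < (k+1)T`. Hence `E‖x(t)‖^m` is at most the tail sum of `M^m
E‖x_d(k)‖^m` over such `k`, which decays exponentially in `t`.

Continuous to discrete: dwell times may be arbitrarily short, so sampling at fixed times does not
suffice. Instead, integrating `E‖x(t)‖^m` over `t` bounds `∑ E[‖x_d(k)‖^m h_k]`. By the Markov
property `h_k` may be replaced by its mean given `σ_k`, which is bounded below because there are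
finitely many modes. So `∑ E‖x_d(k)‖^m ≤ K‖x₀‖^m` (`exists_tsum_lintegral_trajectory_le`). A
Datko-type argument (`meanStep_iterate_le`) turns summability, uniform over initial data, into
geometric decay: the sum is a Lyapunov function for the Markov chain `(σ_k, x_d(k))`. -/

instance matrixSecondCountable {n : ℕ} : SecondCountableTopology (Matrix (Fin n) (Fin n) ℝ) :=
  inferInstanceAs (SecondCountableTopology (Fin n → Fin n → ℝ))

/-! ### Linear flows and operator exponentials. -/

section Flow

variable {E : Type*} [NormedAddCommGroup E] [NormedSpace ℝ E]

theorem exp_sub_self_smul_apply (B : E →L[ℝ] E) (t : ℝ) (x : E) :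
    NormedSpace.exp ((t - t) • B) x = x := by
  simp

variable [CompleteSpace E]

theorem continuous_exp_clm : Continuous (NormedSpace.exp : (E →L[ℝ] E) → E →L[ℝ] E) :=
  letI : NormedAlgebra ℚ (E →L[ℝ] E) := .restrictScalars ℚ ℝ _
  NormedSpace.exp_continuous

theorem exists_norm_exp_smul_le {ι : Type*} [Fintype ι] (B : ι → E →L[ℝ] E) (T : ℝ) :
    ∃ M : ℝ, 0 < M ∧ ∀ l s, |s| ≤ T → ‖NormedSpace.exp (s • B l)‖ ≤ M := by
  have h (l : ι) : ∃ M : ℝ, ∀ s ∈ Icc (-T) T, ‖NormedSpace.exp (s • B l)‖ ≤ M :=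
    isCompact_Icc.exists_bound_of_continuousOn
      (continuous_exp_clm.comp (by fun_prop)).continuousOn
  choose M hM using h
  refine ⟨1 + ∑ l, |M l|, by positivity, fun l s hs => ?_⟩
  have h1 := hM l s (abs_le.mp hs)
  have h2 := Finset.single_le_sum (f := fun l => |M l|) (fun l _ => abs_nonneg _)
    (Finset.mem_univ l)
  have h3 := le_abs_self (M l)
  linarith

theorem exp_neg_smul_apply (B : E →L[ℝ] E) (s : ℝ) (x : E) :
    NormedSpace.exp ((-s) • B) (NormedSpace.exp (s • B) x) = x := by
  let : NormedAlgebra ℚ (E →L[ℝ] E) := .restrictScalars ℚ ℝ _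
  rw [← mul_apply_eq_comp, ← NormedSpace.exp_add_of_commute, ← add_smul]
  · simp
  · exact ((Commute.refl B).smul_left _).smul_right _

theorem hasDerivAt_exp_sub_smul_apply (B : E →L[ℝ] E) (t₀ t : ℝ) (x : E) :
    HasDerivAt (fun s => NormedSpace.exp ((s - t₀) • B) x)
      (B (NormedSpace.exp ((t - t₀) • B) x)) t := by
  have h := (hasDerivAt_exp_smul_const' B (t - t₀)).scomp t ((hasDerivAt_id t).sub_const t₀)
  simpa using h.clm_apply (hasDerivAt_const t x)

/-- Solutions of `x' = B x` on a half-open interval are given by the exponential. -/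
theorem eq_exp_apply_of_hasDerivWithinAt (B : E →L[ℝ] E) {a b : ℝ} {x : ℝ → E}
    (hx : ∀ t ∈ Ico a b, HasDerivWithinAt x (B (x t)) (Ico a b) t) {t : ℝ} (ht : t ∈ Ico a b) :
    x t = NormedSpace.exp ((t - a) • B) (x a) := by
  -- Integrating factor: `exp (-(s - a) B) x(s)` has zero derivative, hence is constant on the
  -- interval.
  have hd : ∀ s ∈ Ico a b,
      HasDerivWithinAt (fun s => NormedSpace.exp ((s - a) • (-B)) (x s)) 0 (Ico a b) s := by
    intro s hs
    have h := (hasDerivAt_exp_smul_const (-B) (s - a)).scomp s ((hasDerivAt_id s).sub_const a)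
    have h2 := h.hasDerivWithinAt.clm_apply (hx s hs)
    refine h2.congr_deriv ?_
    simp
  have hc := (convex_Ico a b).is_const_of_fderivWithin_eq_zero (𝕜 := ℝ)
    (fun s hs => (hd s hs).differentiableWithinAt)
    (fun s hs => by
      have hu : UniqueDiffWithinAt ℝ (Ico a b) s := uniqueDiffOn_Ico a b s hs
      rw [(hd s hs).hasFDerivWithinAt.fderivWithin hu]
      ext
      simp)
    ht (⟨le_rfl, ht.1.trans_lt ht.2⟩ : a ∈ Ico a b)
  simp only [sub_self, zero_smul, NormedSpace.exp_zero, one_apply_eq_self] at hc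
  have h := exp_neg_smul_apply B (-(t - a)) (x t)
  rw [neg_neg] at h
  rw [← h, ← hc, smul_neg, neg_smul]

end Flow

/-! ### Matrix exponentials as operators on Euclidean space. -/

section MatrixExp

variable {n : ℕ}

theorem continuous_toEuclideanCLM :
    Continuous (Matrix.toEuclideanCLM (n := Fin n) (𝕜 := ℝ)) :=
  LinearMap.continuous_of_finiteDimensional
    (Matrix.toEuclideanCLM (n := Fin n) (𝕜 := ℝ)).toAlgEquiv.toLinearMap

theorem toEuclideanCLM_exp (M : Matrix (Fin n) (Fin n) ℝ) :
    Matrix.toEuclideanCLM (𝕜 := ℝ) (NormedSpace.exp M) =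
      NormedSpace.exp (Matrix.toEuclideanCLM (𝕜 := ℝ) M) := by
  let : NormedRing (Matrix (Fin n) (Fin n) ℝ) := Matrix.linftyOpNormedRing
  let : NormedAlgebra ℝ (Matrix (Fin n) (Fin n) ℝ) := Matrix.linftyOpNormedAlgebra
  let : NormedAlgebra ℚ (Matrix (Fin n) (Fin n) ℝ) := .restrictScalars ℚ ℝ _
  exact NormedSpace.map_exp (Matrix.toEuclideanCLM (n := Fin n) (𝕜 := ℝ))
    continuous_toEuclideanCLM M

end MatrixExp

/-! ### The Markov property as a transition kernel. -/

section Markov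

variable {N n : ℕ} {Ω : Type*} [MeasurableSpace Ω] (S : SwitchedSystem N n Ω)

theorem dwell_nonneg (i : Fin N) (k : ℕ) (ω : Ω) : 0 ≤ S.dwell i k ω :=
  sub_nonneg.mpr (S.time_mono i ω k.le_succ)

theorem measurable_dwell (i : Fin N) (k : ℕ) : Measurable (S.dwell i k) :=
  (S.measurable_time i (k + 1)).sub (S.measurable_time i k)

/-- The triple `(σ_{k+1}, h_k, J_k)`. -/
def transition (i : Fin N) (k : ℕ) (ω : Ω) : Fin N × ℝ × Matrix (Fin n) (Fin n) ℝ :=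
  (S.mode i (k + 1) ω, S.dwell i k ω, S.J i k ω)

theorem measurable_transition (i : Fin N) (k : ℕ) : Measurable (S.transition i k) :=
  (S.measurable_mode i (k + 1)).prodMk ((S.measurable_dwell i k).prodMk (S.measurable_J i k))

/-- The law of the first transition from each mode. -/
def transitionKernel (P : Measure Ω) :
    Kernel (Fin N) (Fin N × ℝ × Matrix (Fin n) (Fin n) ℝ) :=
  Kernel.ofFunOfCountable fun l => P.map (S.transition l 0)

theorem transitionKernel_apply (P : Measure Ω) (l : Fin N) :
    S.transitionKernel P l = P.map (S.transition l 0) := rfl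

instance isMarkovKernel_transitionKernel (P : Measure Ω) [IsProbabilityMeasure P] :
    IsMarkovKernel (S.transitionKernel P) :=
  ⟨fun l => Measure.isProbabilityMeasure_map (S.measurable_transition l 0).aemeasurable⟩

theorem history_le (i : Fin N) (k : ℕ) : S.history i k ≤ ‹MeasurableSpace Ω› :=
  sup_le (sup_le (iSup₂_le fun l _ => (S.measurable_mode i l).comap_le)
    (iSup₂_le fun l _ => (S.measurable_time i l).comap_le))
    (iSup₂_le fun l _ => (S.measurable_J i l).comap_le)

theorem measurable_mode_history (i : Fin N) {l k : ℕ} (h : l ≤ k) :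
    Measurable[S.history i k] (S.mode i l) :=
  measurable_iff_comap_le.mpr <| (le_iSup₂_of_le (f := fun l (_ : l ≤ k) =>
    MeasurableSpace.comap (S.mode i l) inferInstance) l h le_rfl).trans
      (le_sup_left.trans le_sup_left)

theorem measurable_time_history (i : Fin N) {l k : ℕ} (h : l ≤ k) :
    Measurable[S.history i k] (S.time i l) :=
  measurable_iff_comap_le.mpr <| (le_iSup₂_of_le (f := fun l (_ : l ≤ k) =>
    MeasurableSpace.comap (S.time i l) inferInstance) l h le_rfl).trans
      (le_sup_right.trans le_sup_left)

theorem measurable_J_history (i : Fin N) {l k : ℕ} (h : l < k) :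
    Measurable[S.history i k] (S.J i l) :=
  measurable_iff_comap_le.mpr <| (le_iSup₂_of_le (f := fun l (_ : l < k) =>
    MeasurableSpace.comap (S.J i l) inferInstance) l h le_rfl).trans le_sup_right

theorem measurableSet_jumpEvent (i : Fin N) (k : ℕ) (j : Fin N) (s : ℝ)
    {B : Set (Matrix (Fin n) (Fin n) ℝ)} (hB : MeasurableSet B) :
    MeasurableSet (S.jumpEvent i k j s B) :=
  (S.measurable_mode i (k + 1) (measurableSet_singleton j)).inter
    ((S.measurable_dwell i k measurableSet_Iic).inter (S.measurable_J i k hB))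

theorem jumpEvent_eq (i : Fin N) (k : ℕ) (j : Fin N) (s : ℝ)
    (B : Set (Matrix (Fin n) (Fin n) ℝ)) :
    S.jumpEvent i k j s B = S.transition i k ⁻¹' ({j} ×ˢ Iic s ×ˢ B) := by
  ext ω
  simp [jumpEvent, transition]

variable {S} {P : Measure Ω} [IsProbabilityMeasure P]

/-- From initial mode `l` the mode at step `0` is surely `l`, so homogeneity identifies the
conditional probability given `σ_k = l` with the unconditional probability of a first jump from `l`.
-/
theorem measure_inter_jumpEvent (hS : S.IsSemiMarkov P) (i : Fin N) (k : ℕ) {A : Set Ω}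
    (hA : MeasurableSet[S.history i k] A) (l j : Fin N) {s : ℝ} (hs : 0 ≤ s)
    {B : Set (Matrix (Fin n) (Fin n) ℝ)} (hB : MeasurableSet B) :
    P (A ∩ S.mode i k ⁻¹' {l} ∩ S.jumpEvent i k j s B) =
      P (A ∩ S.mode i k ⁻¹' {l}) * P (S.jumpEvent l 0 j s B) := by
  have hE := S.measurableSet_jumpEvent i k j s hB
  have hm := S.history_le i k
  have hl : MeasurableSet (S.mode i k ⁻¹' {l}) :=
    S.measurable_mode i k (measurableSet_singleton l)
  -- The conditional probability given `σ_k` is a function `g` of `σ_k`, hence equals the constant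
  -- `g l` on `{σ_k = l}`.
  obtain ⟨g, -, hg⟩ := Measurable.exists_eq_measurable_comp
    (stronglyMeasurable_condExp (μ := P) (m := MeasurableSpace.comap (S.mode i k) inferInstance)
      (f := (S.jumpEvent i k j s B).indicator fun _ => (1 : ℝ))).measurable
  have key : ∀ A' : Set Ω, MeasurableSet[S.history i k] A' →
      P.real (A' ∩ S.mode i k ⁻¹' {l} ∩ S.jumpEvent i k j s B) =
        P.real (A' ∩ S.mode i k ⁻¹' {l}) * g l := by
    intro A' hA'
    have hA'l : MeasurableSet[S.history i k] (A' ∩ S.mode i k ⁻¹' {l}) :=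
      hA'.inter (S.measurable_mode_history i le_rfl (measurableSet_singleton l))
    have h1 := setIntegral_condExp (μ := P) hm
      ((integrable_const (1 : ℝ)).indicator hE) hA'l
    rw [setIntegral_congr_ae (g := fun _ => g l) (hm _ hA'l)
      (by
        filter_upwards [hS.markov i k j s B hs hB] with ω hω hωl
        rw [hω, hg]
        exact congrArg g hωl.2)] at h1
    rw [setIntegral_const, setIntegral_indicator hE, setIntegral_const] at h1
    simpa using h1.symm
  have hreal : P.real (A ∩ S.mode i k ⁻¹' {l} ∩ S.jumpEvent i k j s B) =
      P.real (A ∩ S.mode i k ⁻¹' {l}) * P.real (S.jumpEvent l 0 j s B) := by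
    -- Homogeneity says nothing when `{σ_k = l}` is null, but then both sides vanish.
    by_cases h0 : P (S.mode i k ⁻¹' {l}) = 0
    · have h1 : P (A ∩ S.mode i k ⁻¹' {l}) = 0 := measure_mono_null inter_subset_right h0
      rw [measureReal_def, measure_mono_null inter_subset_left h1, measureReal_def, h1]
      simp
    · rw [key A hA]
      congr 1
      have hu : S.mode l 0 ⁻¹' {l} = univ := by
        ext ω
        simp [S.mode_zero]
      have h2 := hS.homogeneous i l k 0 l j s B hs hB h0 (by rw [hu]; simp)
      rw [cond_apply hl, hu, cond_univ] at h2
      have h3 := key univ MeasurableSet.univ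
      rw [univ_inter] at h3
      rw [measureReal_def, ← h2, ENNReal.toReal_mul, ENNReal.toReal_inv, ← measureReal_def,
        ← measureReal_def, h3]
      have : P.real (S.mode i k ⁻¹' {l}) ≠ 0 := by
        rw [measureReal_def]
        exact ENNReal.toReal_ne_zero.mpr ⟨h0, measure_ne_top _ _⟩
      field_simp
  rw [measureReal_def, measureReal_def, measureReal_def, ← ENNReal.toReal_mul] at hreal
  exact (ENNReal.toReal_eq_toReal_iff' (measure_ne_top _ _)
    (ENNReal.mul_ne_top (measure_ne_top _ _) (measure_ne_top _ _))).mp hreal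

/-- Finite measures on `ℝ` are determined by half-lines, so with `j` and `B` fixed the thresholds `h
≤ s` determine the law of `h`; a countable union over `j` then reaches all boxes. -/
theorem map_transition_restrict (hS : S.IsSemiMarkov P) (i : Fin N) (k : ℕ) {A : Set Ω}
    (hA : MeasurableSet[S.history i k] A) (l : Fin N) :
    (P.restrict (A ∩ S.mode i k ⁻¹' {l})).map (S.transition i k) =
      P (A ∩ S.mode i k ⁻¹' {l}) • S.transitionKernel P l := by
  set A' := A ∩ S.mode i k ⁻¹' {l} with hA'
  have h1 : ∀ (j : Fin N) (s : ℝ) (B : Set (Matrix (Fin n) (Fin n) ℝ)), MeasurableSet B →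
      (P.restrict A').map (S.transition i k) ({j} ×ˢ Iic s ×ˢ B) =
        (P A' • S.transitionKernel P l) ({j} ×ˢ Iic s ×ˢ B) := by
    intro j s B hB
    have hm : MeasurableSet (({j} : Set (Fin N)) ×ˢ Iic s ×ˢ B) :=
      (measurableSet_singleton j).prod (measurableSet_Iic.prod hB)
    rw [Measure.map_apply (S.measurable_transition i k) hm, Measure.smul_apply,
      transitionKernel_apply, Measure.map_apply (S.measurable_transition l 0) hm,
      ← jumpEvent_eq, ← jumpEvent_eq,
      Measure.restrict_apply (S.measurableSet_jumpEvent i k j s hB), inter_comm, smul_eq_mul]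
    rcases le_or_gt 0 s with hs | hs
    · exact measure_inter_jumpEvent hS i k hA l j hs hB
    -- The Markov property is assumed only for `s ≥ 0`; for `s < 0` the event is empty because dwell
    -- times are nonnegative.
    · have he : ∀ i k, S.jumpEvent i k j s B = ∅ := fun i k => by
        ext ω
        simp only [jumpEvent, mem_ofPred_eq, mem_empty_iff_false, iff_false]
        intro h
        linarith [S.dwell_nonneg i k ω, h.2.1]
      simp [he]
  have : IsFiniteMeasure (P A' • S.transitionKernel P l) :=
    Measure.smul_finite _ (measure_ne_top _ _)
  refine Measure.ext_prod₃ fun {D U B} hD hU hB => ?_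
  have h2 : ∀ j : Fin N, (P.restrict A').map (S.transition i k) ({j} ×ˢ U ×ˢ B) =
      (P A' • S.transitionKernel P l) ({j} ×ˢ U ×ˢ B) := by
    intro j
    let proj : Fin N × ℝ × Matrix (Fin n) (Fin n) ℝ → ℝ := fun z => z.2.1
    have hproj : Measurable proj := by fun_prop
    let W : Set (Fin N × ℝ × Matrix (Fin n) (Fin n) ℝ) := {z | z.1 = j ∧ z.2.2 ∈ B}
    have e : ∀ U : Set ℝ, ({j} : Set (Fin N)) ×ˢ U ×ˢ B = proj ⁻¹' U ∩ W := by
      intro U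
      ext z
      simp [proj, W]
      tauto
    have h3 : (((P.restrict A').map (S.transition i k)).restrict W).map proj =
        ((P A' • S.transitionKernel P l).restrict W).map proj := by
      refine Measure.ext_of_Iic _ _ fun s => ?_
      rw [Measure.map_apply hproj measurableSet_Iic, Measure.map_apply hproj measurableSet_Iic,
        Measure.restrict_apply (hproj measurableSet_Iic),
        Measure.restrict_apply (hproj measurableSet_Iic), ← e, h1 j s B hB]
    have h4 := congrArg (fun μ => μ U) h3
    rwa [Measure.map_apply hproj hU, Measure.map_apply hproj hU,
      Measure.restrict_apply (hproj hU), Measure.restrict_apply (hproj hU), ← e] at h4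
  have e2 : D ×ˢ U ×ˢ B = ⋃ j ∈ D, ({j} : Set (Fin N)) ×ˢ U ×ˢ B := by
    ext z
    simp
    tauto
  have hdisj : D.PairwiseDisjoint fun j : Fin N => ({j} : Set (Fin N)) ×ˢ U ×ˢ B := by
    intro a _ b _ hab
    refine disjoint_left.mpr fun z hz hz' => hab ?_
    rw [← (mem_singleton_iff.mp hz.1), ← (mem_singleton_iff.mp hz'.1)]
  have hmeas : ∀ j ∈ D, MeasurableSet (({j} : Set (Fin N)) ×ˢ U ×ˢ B) :=
    fun j _ => (measurableSet_singleton j).prod (hU.prod hB)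
  rw [e2, measure_biUnion D.to_countable hdisj hmeas, measure_biUnion D.to_countable hdisj hmeas]
  exact tsum_congr fun j => h2 j

/-- The Markov property for functions of the past and of the next transition. -/
theorem lintegral_transition (hS : S.IsSemiMarkov P) (i : Fin N) (k : ℕ) {α : Type*}
    [MeasurableSpace α] {Y : Ω → α} (hY : Measurable[S.history i k] Y)
    {G : α × (Fin N × ℝ × Matrix (Fin n) (Fin n) ℝ) → ℝ≥0∞} (hG : Measurable G) :
    ∫⁻ ω, G (Y ω, S.transition i k ω) ∂P =
      ∫⁻ ω, ∫⁻ z, G (Y ω, z) ∂S.transitionKernel P (S.mode i k ω) ∂P := by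
  have hY' : Measurable Y := hY.mono (S.history_le i k) le_rfl
  have hZ := S.measurable_transition i k
  have hmode : ∀ l, MeasurableSet (S.mode i k ⁻¹' {l}) := fun l =>
    S.measurable_mode i k (measurableSet_singleton l)
  -- On `{σ_k = l}` the past and the next transition are independent: their joint law is a product.
  have hlaw : ∀ l, (P.restrict (S.mode i k ⁻¹' {l})).map (fun ω => (Y ω, S.transition i k ω)) =
      ((P.restrict (S.mode i k ⁻¹' {l})).map Y).prod (S.transitionKernel P l) := by
    intro l
    refine Measure.ext_prod fun {s t} hs ht => ?_
    rw [Measure.prod_prod, Measure.map_apply (hY'.prodMk hZ) (hs.prod ht),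
      Measure.map_apply hY' hs, mk_preimage_prod, Measure.restrict_apply (hY' hs)]
    have h := congrArg (fun μ => μ t) (map_transition_restrict hS i k (hY hs) l)
    simp only [Measure.smul_apply, smul_eq_mul] at h
    rw [← h, Measure.map_apply hZ ht, Measure.restrict_apply (hZ ht),
      Measure.restrict_apply ((hY' hs).inter (hZ ht))]
    congr 1
    ext ω
    simp
    tauto
  have hcover : ⋃ l, S.mode i k ⁻¹' {l} = univ := by
    ext ω
    simp
  have hdisj : Pairwise (Function.onFun Disjoint fun l => S.mode i k ⁻¹' {l}) :=
    fun a b hab => Disjoint.preimage _ (disjoint_singleton.mpr hab)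
  rw [← setLIntegral_univ, ← setLIntegral_univ (μ := P), ← hcover,
    lintegral_iUnion hmode hdisj, lintegral_iUnion hmode hdisj]
  refine tsum_congr fun l => ?_
  have hr : ∫⁻ ω in S.mode i k ⁻¹' {l}, ∫⁻ z, G (Y ω, z) ∂S.transitionKernel P (S.mode i k ω) ∂P =
      ∫⁻ ω in S.mode i k ⁻¹' {l}, ∫⁻ z, G (Y ω, z) ∂S.transitionKernel P l ∂P :=
    setLIntegral_congr_fun (hmode l) fun ω hω => by
      rw [mem_preimage, mem_singleton_iff] at hω
      simp only [hω]
  rw [hr, ← lintegral_map hG (hY'.prodMk hZ), hlaw l, lintegral_prod _ hG.aemeasurable,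
    lintegral_map hG.lintegral_prod_right' hY']

end Markov

/-! ### The Markov chain `(σ_k, x_d(k))` and its Lyapunov function. -/

section MeanDynamics

variable {N n : ℕ} {Ω : Type*} [MeasurableSpace Ω] (S : SwitchedSystem N n Ω)

/-- The state at the end of a transition `z = (j, h, J)` from mode `l` and state `x`. -/
def step (l : Fin N) (z : Fin N × ℝ × Matrix (Fin n) (Fin n) ℝ) (x : EuclideanSpace ℝ (Fin n)) :
    EuclideanSpace ℝ (Fin n) :=
  Matrix.toEuclideanCLM (𝕜 := ℝ) (z.2.2 * NormedSpace.exp (z.2.1 • S.A l)) x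

theorem step_eq (l : Fin N) (z : Fin N × ℝ × Matrix (Fin n) (Fin n) ℝ)
    (x : EuclideanSpace ℝ (Fin n)) :
    S.step l z x = Matrix.toEuclideanCLM (𝕜 := ℝ) z.2.2
      (NormedSpace.exp (z.2.1 • Matrix.toEuclideanCLM (𝕜 := ℝ) (S.A l)) x) := by
  rw [step, map_mul, toEuclideanCLM_exp, map_smul, mul_apply_eq_comp]

theorem measurable_step (l : Fin N) :
    Measurable fun p : (Fin N × ℝ × Matrix (Fin n) (Fin n) ℝ) × EuclideanSpace ℝ (Fin n) =>
      S.step l p.1 p.2 := by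
  simp only [step_eq]
  have h1 := continuous_toEuclideanCLM (n := n)
  have h2 := continuous_exp_clm (E := EuclideanSpace ℝ (Fin n))
  refine Continuous.measurable ?_
  refine (h1.comp (by fun_prop)).clm_apply ?_
  exact (h2.comp (by fun_prop)).clm_apply continuous_snd

theorem trajectory_succ (i : Fin N) (x₀ : EuclideanSpace ℝ (Fin n)) (k : ℕ) (ω : Ω) :
    S.discretization.trajectory i x₀ (k + 1) ω =
      S.step (S.mode i k ω) (S.transition i k ω) (S.discretization.trajectory i x₀ k ω) := rfl

attribute [irreducible] step

theorem measurable_step_uncurry :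
    Measurable fun p : Fin N × (Fin N × ℝ × Matrix (Fin n) (Fin n) ℝ) ×
      EuclideanSpace ℝ (Fin n) => S.step p.1 p.2.1 p.2.2 :=
  measurable_from_prod_countable_right fun l => S.measurable_step l

/-- `x_d(k)` uses the modes before step `k`, the times up to `t_k` and the jumps up to `J_{k-1}`,
all in `history`; this lets the Markov property apply to it. -/
theorem measurable_trajectory_history (i : Fin N) (x₀ : EuclideanSpace ℝ (Fin n)) (k : ℕ) :
    Measurable[S.history i k] (S.discretization.trajectory i x₀ k) := by
  suffices h : ∀ r ≤ k, Measurable[S.history i k] (S.discretization.trajectory i x₀ r) from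
    h k le_rfl
  intro r
  induction r with
  | zero => exact fun _ => measurable_const
  | succ r ih =>
    intro hr
    have hz : Measurable[S.history i k] (S.transition i r) :=
      (S.measurable_mode_history i hr).prodMk
        (((S.measurable_time_history i hr).sub (S.measurable_time_history i (by omega))).prodMk
          (S.measurable_J_history i (by omega)))
    simp only [funext fun ω => S.trajectory_succ i x₀ r ω]
    exact S.measurable_step_uncurry.comp
      ((S.measurable_mode_history i (by omega)).prodMk (hz.prodMk (ih (by omega))))

theorem measurable_trajectory (i : Fin N) (x₀ : EuclideanSpace ℝ (Fin n)) (k : ℕ) :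
    Measurable (S.discretization.trajectory i x₀ k) :=
  (S.measurable_trajectory_history i x₀ k).mono (S.history_le i k) le_rfl

/-- The transition operator of the Markov chain `(σ_k, x_d(k))`. -/
def meanStep (P : Measure Ω) (f : Fin N × EuclideanSpace ℝ (Fin n) → ℝ≥0∞) :
    Fin N × EuclideanSpace ℝ (Fin n) → ℝ≥0∞ :=
  fun p => ∫⁻ z, f (z.1, S.step p.1 z p.2) ∂S.transitionKernel P p.1

variable {S} {P : Measure Ω}

theorem meanStep_mono {f g : Fin N × EuclideanSpace ℝ (Fin n) → ℝ≥0∞} (h : f ≤ g) :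
    S.meanStep P f ≤ S.meanStep P g :=
  fun _ => lintegral_mono fun _ => h _

theorem meanStep_const_mul {c : ℝ≥0∞} (hc : c ≠ ⊤)
    (f : Fin N × EuclideanSpace ℝ (Fin n) → ℝ≥0∞) :
    S.meanStep P (fun p => c * f p) = fun p => c * S.meanStep P f p :=
  funext fun _ => lintegral_const_mul' c _ hc

variable [IsProbabilityMeasure P]

theorem measurable_meanStep {f : Fin N × EuclideanSpace ℝ (Fin n) → ℝ≥0∞} (hf : Measurable f) :
    Measurable (S.meanStep P f) := by
  refine measurable_from_prod_countable_right fun l => ?_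
  have h : Measurable fun q : EuclideanSpace ℝ (Fin n) ×
      (Fin N × ℝ × Matrix (Fin n) (Fin n) ℝ) => f (q.2.1, S.step l q.2 q.1) :=
    hf.comp (measurable_snd.fst.prodMk ((S.measurable_step l).comp measurable_swap))
  exact h.lintegral_prod_right' (ν := S.transitionKernel P l)

theorem measurable_meanStep_iterate {f : Fin N × EuclideanSpace ℝ (Fin n) → ℝ≥0∞}
    (hf : Measurable f) (k : ℕ) : Measurable ((S.meanStep P)^[k] f) := by
  induction k with
  | zero => exact hf
  | succ k ih =>
    rw [Function.iterate_succ_apply']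
    exact measurable_meanStep ih

/-- The last transition is integrated out first, replacing `f` by `meanStep P f` and `k + 1` by `k`.
-/
theorem lintegral_trajectory (hS : S.IsSemiMarkov P) (i : Fin N) (x₀ : EuclideanSpace ℝ (Fin n))
    (k : ℕ) {f : Fin N × EuclideanSpace ℝ (Fin n) → ℝ≥0∞} (hf : Measurable f) :
    ∫⁻ ω, f (S.mode i k ω, S.discretization.trajectory i x₀ k ω) ∂P =
      (S.meanStep P)^[k] f (i, x₀) := by
  induction k generalizing f with
  | zero => simp [S.mode_zero, DiscreteSwitchedSystem.trajectory]
  | succ k ih =>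
    rw [Function.iterate_succ_apply, ← ih (measurable_meanStep hf)]
    have hY := (S.measurable_mode_history i (le_refl k)).prodMk
      (S.measurable_trajectory_history i x₀ k)
    have hG : Measurable fun q : (Fin N × EuclideanSpace ℝ (Fin n)) ×
        (Fin N × ℝ × Matrix (Fin n) (Fin n) ℝ) => f (q.2.1, S.step q.1.1 q.2 q.1.2) :=
      hf.comp (measurable_snd.fst.prodMk (S.measurable_step_uncurry.comp
        (measurable_fst.fst.prodMk (measurable_snd.prodMk measurable_fst.snd))))
    simp only [trajectory_succ]
    exact lintegral_transition hS i k hY hG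

/-- If the sums of the iterates are bounded by a multiple of `φ`, they are a Lyapunov function,
and the iterates decay geometrically. -/
theorem meanStep_iterate_le {φ : Fin N × EuclideanSpace ℝ (Fin n) → ℝ≥0∞} (hφ : Measurable φ)
    (hφt : ∀ p, φ p ≠ ⊤) {K : ℝ≥0∞} (hKt : K ≠ ⊤)
    (hK : ∀ p, ∑' k, (S.meanStep P)^[k] φ p ≤ K * φ p) (k : ℕ)
    (p : Fin N × EuclideanSpace ℝ (Fin n)) :
    (S.meanStep P)^[k] φ p ≤ K * (1 - K⁻¹) ^ k * φ p := by
  set W : Fin N × EuclideanSpace ℝ (Fin n) → ℝ≥0∞ := fun p => ∑' k, (S.meanStep P)^[k] φ p with hW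
  have hWt : ∀ p, W p ≠ ⊤ := fun p =>
    ne_top_of_le_ne_top (ENNReal.mul_ne_top hKt (hφt p)) (hK p)
  have hsplit : ∀ p, φ p + S.meanStep P W p = W p := by
    intro p
    have h1 : S.meanStep P W p = ∑' k, (S.meanStep P)^[k + 1] φ p := by
      simp only [Function.iterate_succ_apply']
      refine lintegral_tsum fun k => Measurable.aemeasurable ?_
      exact (measurable_meanStep_iterate hφ k).comp (measurable_fst.prodMk
        ((S.measurable_step p.1).comp (measurable_id.prodMk measurable_const)))
    rw [h1, hW]
    exact (tsum_eq_zero_add' (f := fun k => (S.meanStep P)^[k] φ p) ENNReal.summable).symm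
  have hr : (1 - K⁻¹ : ℝ≥0∞) ≠ ⊤ := ne_top_of_le_ne_top ENNReal.one_ne_top tsub_le_self
  -- Since `W ≤ K φ`, the image of `W` is `W - φ ≤ (1 - 1/K) W`.
  have hdecr : S.meanStep P W ≤ fun p => (1 - K⁻¹) * W p := by
    intro p
    have h1 : K⁻¹ * W p ≤ φ p := by
      rw [mul_comm, ← div_eq_mul_inv]
      exact ENNReal.div_le_of_le_mul' (hK p)
    have h2 : K⁻¹ * W p ≠ ⊤ := ne_top_of_le_ne_top (hφt p) h1
    simp only [ENNReal.sub_mul fun _ _ => hWt p, one_mul]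
    refine ENNReal.le_sub_of_add_le_left h2 ?_
    rw [← hsplit p] at *
    gcongr
  have hiter : ∀ k, (S.meanStep P)^[k] W ≤ fun p => (1 - K⁻¹) ^ k * W p := by
    intro k
    induction k with
    | zero => intro p; simp
    | succ k ih =>
      rw [Function.iterate_succ_apply']
      refine (meanStep_mono ih).trans ?_
      rw [meanStep_const_mul (ENNReal.pow_ne_top hr)]
      intro p
      simp only [pow_succ, mul_assoc]
      gcongr
      exact hdecr p
  have hφW : φ ≤ W := fun p => by
    rw [← hsplit p]
    exact le_self_add
  have hmono : Monotone (S.meanStep P) := fun _ _ h => meanStep_mono h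
  calc (S.meanStep P)^[k] φ p ≤ (S.meanStep P)^[k] W p := hmono.iterate k hφW p
    _ ≤ (1 - K⁻¹) ^ k * W p := hiter k p
    _ ≤ (1 - K⁻¹) ^ k * (K * φ p) := by gcongr; exact hK p
    _ = K * (1 - K⁻¹) ^ k * φ p := by ring

end MeanDynamics

/-! ### Mean dwell times and non-accumulation of switching times. -/

section Dwell

variable {N n : ℕ} {Ω : Type*} [MeasurableSpace Ω] {S : SwitchedSystem N n Ω}
  {P : Measure Ω} [IsProbabilityMeasure P]

theorem time_succ (i : Fin N) (k : ℕ) (ω : Ω) :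
    S.time i (k + 1) ω = S.time i k ω + S.dwell i k ω := by
  simp [dwell]

/-- Used with `g` the identity for the lower bound on moments, and with `g = exp(-·)` for
non-accumulation. -/
theorem lintegral_mul_dwell (hS : S.IsSemiMarkov P) (i : Fin N) (k : ℕ) {f : Ω → ℝ≥0∞}
    (hf : Measurable[S.history i k] f) {g : ℝ → ℝ≥0∞} (hg : Measurable g) :
    ∫⁻ ω, f ω * g (S.dwell i k ω) ∂P =
      ∫⁻ ω, f ω * ∫⁻ ω', g (S.dwell (S.mode i k ω) 0 ω') ∂P ∂P := by
  have hG : Measurable fun q : ℝ≥0∞ × (Fin N × ℝ × Matrix (Fin n) (Fin n) ℝ) =>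
      q.1 * g q.2.2.1 := by fun_prop
  have hg' : Measurable fun z : Fin N × ℝ × Matrix (Fin n) (Fin n) ℝ => g z.2.1 := by fun_prop
  have h := lintegral_transition hS i k hf hG
  simp only [lintegral_const_mul _ hg', transitionKernel_apply,
    lintegral_map hg' (S.measurable_transition _ 0)] at h
  exact h

theorem exists_le_lintegral_dwell (hpos : ∀ l, ∀ᵐ ω ∂P, 0 < S.dwell l 0 ω) :
    ∃ δ : ℝ≥0∞, δ ≠ 0 ∧ δ ≠ ⊤ ∧
      ∀ l, δ ≤ ∫⁻ ω, ENNReal.ofReal (S.dwell l 0 ω) ∂P := by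
  -- Finitely many positive means have a positive minimum; the `1` keeps it finite, even when there
  -- are no modes.
  refine ⟨min 1 (Finset.univ.inf fun l => ∫⁻ ω, ENNReal.ofReal (S.dwell l 0 ω) ∂P), ?_, ?_, ?_⟩
  · refine (lt_min one_pos ((Finset.lt_inf_iff ENNReal.zero_lt_top).mpr fun l _ => ?_)).ne'
    refine pos_iff_ne_zero.mpr fun h0 => ?_
    rw [lintegral_eq_zero_iff (S.measurable_dwell l 0).ennreal_ofReal] at h0
    have hF : ∀ᵐ ω ∂P, False := by
      filter_upwards [h0, hpos l] with ω h1 h2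
      simp only [Pi.zero_apply, ENNReal.ofReal_eq_zero] at h1
      linarith
    exact NeZero.ne P (by simpa using hF)
  · exact ne_top_of_le_ne_top ENNReal.one_ne_top (min_le_left _ _)
  · exact fun l => (min_le_right _ _).trans (Finset.inf_le (Finset.mem_univ l))

theorem exists_lintegral_exp_neg_dwell_le (hpos : ∀ l, ∀ᵐ ω ∂P, 0 < S.dwell l 0 ω) :
    ∃ r : ℝ≥0∞, r < 1 ∧
      ∀ l, ∫⁻ ω, ENNReal.ofReal (Real.exp (-S.dwell l 0 ω)) ∂P ≤ r := by
  refine ⟨Finset.univ.sup fun l => ∫⁻ ω, ENNReal.ofReal (Real.exp (-S.dwell l 0 ω)) ∂P,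
    (Finset.sup_lt_iff (by simp)).mpr fun l _ => ?_,
    fun l => Finset.le_sup (f := fun l => ∫⁻ ω, ENNReal.ofReal (Real.exp (-S.dwell l 0 ω)) ∂P)
      (Finset.mem_univ l)⟩
  have hlt : ∀ᵐ ω ∂P, ENNReal.ofReal (Real.exp (-S.dwell l 0 ω)) < 1 := by
    filter_upwards [hpos l] with ω hω
    rw [ENNReal.ofReal_lt_one, Real.exp_lt_one_iff]
    linarith
  have h1 : ∫⁻ _, (1 : ℝ≥0∞) ∂P = 1 := by simp
  rw [← h1]
  refine lintegral_strict_mono (NeZero.ne P) aemeasurable_const ?_ hlt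
  refine ne_top_of_le_ne_top ENNReal.one_ne_top ?_
  rw [← h1]
  exact lintegral_mono_ae (hlt.mono fun _ h => h.le)

/-- Almost surely, the switching times exceed any given `t`. -/
theorem ae_exists_lt_time (hS : S.IsSemiMarkov P) (hpos : ∀ l, ∀ᵐ ω ∂P, 0 < S.dwell l 0 ω)
    (i : Fin N) (t : ℝ) : ∀ᵐ ω ∂P, ∃ k, t < S.time i k ω := by
  obtain ⟨r, hr1, hr⟩ := exists_lintegral_exp_neg_dwell_le hpos
  -- Each transition contributes a conditional factor at most `r`; the Chernoff bound `P(t_k ≤ t) ≤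
  -- e^t r^k` then tends to `0`.
  have hexp : ∀ k, ∫⁻ ω, ENNReal.ofReal (Real.exp (-S.time i k ω)) ∂P ≤ r ^ k := by
    intro k
    induction k with
    | zero => simp [S.time_zero]
    | succ k ih =>
      have hf : Measurable[S.history i k] fun ω => ENNReal.ofReal (Real.exp (-S.time i k ω)) :=
        (Real.measurable_exp.comp (S.measurable_time_history i le_rfl).neg).ennreal_ofReal
      have hg : Measurable fun s : ℝ => ENNReal.ofReal (Real.exp (-s)) := by fun_prop
      have h := lintegral_mul_dwell hS i k hf hg
      simp only [← ENNReal.ofReal_mul (Real.exp_pos _).le, ← Real.exp_add, ← neg_add,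
        ← time_succ] at h
      rw [h]
      calc _ ≤ ∫⁻ ω, ENNReal.ofReal (Real.exp (-S.time i k ω)) * r ∂P :=
            lintegral_mono fun ω => by gcongr; exact hr _
        _ = (∫⁻ ω, ENNReal.ofReal (Real.exp (-S.time i k ω)) ∂P) * r :=
            lintegral_mul_const' _ _ (ne_top_of_lt hr1)
        _ ≤ r ^ (k + 1) := by rw [pow_succ]; gcongr
  have hbound : ∀ k, P {ω | ∀ k, S.time i k ω ≤ t} ≤ ENNReal.ofReal (Real.exp t) * r ^ k := by
    intro k
    have hm : MeasurableSet {ω | S.time i k ω ≤ t} := S.measurable_time i k measurableSet_Iic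
    calc P {ω | ∀ k, S.time i k ω ≤ t} ≤ P {ω | S.time i k ω ≤ t} :=
          measure_mono fun ω h => h k
      _ = ∫⁻ ω in {ω | S.time i k ω ≤ t}, 1 ∂P := by simp
      _ ≤ ∫⁻ ω in {ω | S.time i k ω ≤ t},
            ENNReal.ofReal (Real.exp t) * ENNReal.ofReal (Real.exp (-S.time i k ω)) ∂P := by
          refine setLIntegral_mono' hm fun ω hω => ?_
          rw [← ENNReal.ofReal_mul (Real.exp_pos _).le, ← Real.exp_add, ENNReal.one_le_ofReal,
            Real.one_le_exp_iff]
          have : S.time i k ω ≤ t := hω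
          linarith
      _ ≤ ∫⁻ ω, ENNReal.ofReal (Real.exp t) * ENNReal.ofReal (Real.exp (-S.time i k ω)) ∂P :=
          setLIntegral_le_lintegral _ _
      _ ≤ _ := by
          rw [lintegral_const_mul' _ _ ENNReal.ofReal_ne_top]
          gcongr
          exact hexp k
  have hlim : Tendsto (fun k => ENNReal.ofReal (Real.exp t) * r ^ k) atTop (𝓝 0) := by
    have := ENNReal.Tendsto.const_mul (a := ENNReal.ofReal (Real.exp t))
      (ENNReal.tendsto_pow_atTop_nhds_zero_of_lt_one hr1) (Or.inr ENNReal.ofReal_ne_top)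
    simpa using this
  rw [ae_iff]
  simp only [not_exists, not_lt]
  exact le_antisymm (ge_of_tendsto' hlim hbound) zero_le

end Dwell

/-! ### Trajectories and their existence. -/

section Trajectories

variable {N n : ℕ} {Ω : Type*} [MeasurableSpace Ω] (S : SwitchedSystem N n Ω)

/-- The matrix of mode `l` as an operator on Euclidean space. -/
abbrev modeCLM (l : Fin N) : EuclideanSpace ℝ (Fin n) →L[ℝ] EuclideanSpace ℝ (Fin n) :=
  Matrix.toEuclideanCLM (𝕜 := ℝ) (S.A l)

theorem trajectory_succ_eq (i : Fin N) (x₀ : EuclideanSpace ℝ (Fin n)) (k : ℕ) (ω : Ω) :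
    S.discretization.trajectory i x₀ (k + 1) ω = Matrix.toEuclideanCLM (𝕜 := ℝ) (S.J i k ω)
      (NormedSpace.exp (S.dwell i k ω • S.modeCLM (S.mode i k ω))
        (S.discretization.trajectory i x₀ k ω)) := by
  rw [trajectory_succ, step_eq]
  rfl

/-- Within each switching interval a trajectory is the flow started at the discretization. -/
theorem IsTrajectory.ae_eq {P : Measure Ω} (hpos : ∀ i k, ∀ᵐ ω ∂P, 0 < S.dwell i k ω)
    {i : Fin N} {x₀ : EuclideanSpace ℝ (Fin n)} {x : ℝ → Ω → EuclideanSpace ℝ (Fin n)}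
    (hx : S.IsTrajectory P i x₀ x) :
    ∀ᵐ ω ∂P, ∀ k, ∀ t ∈ Ico (S.time i k ω) (S.time i (k + 1) ω), x t ω =
      NormedSpace.exp ((t - S.time i k ω) • S.modeCLM (S.mode i k ω))
        (S.discretization.trajectory i x₀ k ω) := by
  filter_upwards [hx.initial, hx.flow, hx.jump, ae_all_iff.mpr (hpos i)] with ω h0 hf hj hp
  have hflow : ∀ k, ∀ t ∈ Ico (S.time i k ω) (S.time i (k + 1) ω), x t ω =
      NormedSpace.exp ((t - S.time i k ω) • S.modeCLM (S.mode i k ω)) (x (S.time i k ω) ω) :=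
    fun k t ht => eq_exp_apply_of_hasDerivWithinAt (S.modeCLM (S.mode i k ω))
      (x := fun s => x s ω) (hf k) ht
  -- Across a jump, the left limit is unique and must be the value of the flow at the end of the
  -- interval.
  have hstate : ∀ k, x (S.time i k ω) ω = S.discretization.trajectory i x₀ k ω := by
    intro k
    induction k with
    | zero => rw [S.time_zero, h0]; rfl
    | succ k ih =>
      obtain ⟨y, hy, hxy⟩ := hj k
      have hlt : S.time i k ω < S.time i (k + 1) ω := sub_pos.mp (hp k)
      have hc := (hasDerivAt_exp_sub_smul_apply (S.modeCLM (S.mode i k ω)) (S.time i k ω)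
        (S.time i (k + 1) ω) (x (S.time i k ω) ω)).continuousAt.tendsto.mono_left
          (nhdsWithin_le_nhds (s := Iio (S.time i (k + 1) ω)))
      have hy' := hc.congr' (f₂ := fun s => x s ω) (by
        filter_upwards [Ioo_mem_nhdsLT hlt] with s hs
        exact (hflow k s ⟨hs.1.le, hs.2⟩).symm)
      rw [hxy, trajectory_succ_eq, ← ih, tendsto_nhds_unique hy hy']
      rfl
  intro k t ht
  rw [hflow k t ht, hstate]

/-- The flow through the switching intervals, continued by `0` after an accumulation of switching
times. -/
def solution (i : Fin N) (x₀ : EuclideanSpace ℝ (Fin n)) (t : ℝ) (ω : Ω) :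
    EuclideanSpace ℝ (Fin n) :=
  open Classical in
  if h : ∃ k, t ∈ Ico (S.time i k ω) (S.time i (k + 1) ω) then
    NormedSpace.exp ((t - S.time i h.choose ω) • S.modeCLM (S.mode i h.choose ω))
      (S.discretization.trajectory i x₀ h.choose ω)
  else 0

variable {S}

theorem eq_of_mem_Ico_time {i : Fin N} {ω : Ω} {k l : ℕ} {t : ℝ}
    (hk : t ∈ Ico (S.time i k ω) (S.time i (k + 1) ω))
    (hl : t ∈ Ico (S.time i l ω) (S.time i (l + 1) ω)) : k = l := by
  by_contra hne
  exact disjoint_left.mp ((S.time_mono i ω).pairwise_disjoint_on_Ico_succ hne) hk hl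

theorem solution_eq (i : Fin N) (x₀ : EuclideanSpace ℝ (Fin n)) {t : ℝ} {ω : Ω} {k : ℕ}
    (ht : t ∈ Ico (S.time i k ω) (S.time i (k + 1) ω)) :
    S.solution i x₀ t ω = NormedSpace.exp ((t - S.time i k ω) • S.modeCLM (S.mode i k ω))
      (S.discretization.trajectory i x₀ k ω) := by
  have h : ∃ k, t ∈ Ico (S.time i k ω) (S.time i (k + 1) ω) := ⟨k, ht⟩
  rw [solution, dif_pos h, eq_of_mem_Ico_time h.choose_spec ht]

theorem solution_time (i : Fin N) (x₀ : EuclideanSpace ℝ (Fin n)) {ω : Ω} {k : ℕ}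
    (hk : 0 < S.dwell i k ω) :
    S.solution i x₀ (S.time i k ω) ω = S.discretization.trajectory i x₀ k ω := by
  rw [solution_eq i x₀ ⟨le_rfl, sub_pos.mp hk⟩]
  exact exp_sub_self_smul_apply _ _ _

/-- Stability in continuous time quantifies over trajectories, so information about `x_d` can be
drawn from it only once a trajectory exists. -/
theorem isTrajectory_solution {P : Measure Ω} (hpos : ∀ i k, ∀ᵐ ω ∂P, 0 < S.dwell i k ω)
    (i : Fin N) (x₀ : EuclideanSpace ℝ (Fin n)) :
    S.IsTrajectory P i x₀ (S.solution i x₀) where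
  initial := by
    filter_upwards [hpos i 0] with ω hω
    have h := solution_time i x₀ hω
    rwa [S.time_zero] at h
  flow := by
    refine Eventually.of_forall fun ω k t ht => ?_
    rw [solution_eq i x₀ ht]
    exact (hasDerivAt_exp_sub_smul_apply _ _ _ _).hasDerivWithinAt.congr
      (fun s hs => solution_eq i x₀ hs) (solution_eq i x₀ ht)
  jump := by
    filter_upwards [ae_all_iff.mpr (hpos i)] with ω hp k
    refine ⟨NormedSpace.exp (S.dwell i k ω • S.modeCLM (S.mode i k ω))
      (S.discretization.trajectory i x₀ k ω), ?_, ?_⟩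
    · have hc := (hasDerivAt_exp_sub_smul_apply (S.modeCLM (S.mode i k ω)) (S.time i k ω)
        (S.time i (k + 1) ω) (S.discretization.trajectory i x₀ k ω)).continuousAt.tendsto.mono_left
          (nhdsWithin_le_nhds (s := Iio (S.time i (k + 1) ω)))
      refine hc.congr' ?_
      filter_upwards [Ioo_mem_nhdsLT (sub_pos.mp (hp k))] with s hs
      exact (solution_eq i x₀ ⟨hs.1.le, hs.2⟩).symm
    · rw [solution_time i x₀ (hp (k + 1)), trajectory_succ_eq]

end Trajectories

/-! ### The two implications. -/

section Stability

variable {N n : ℕ} {Ω : Type*} [MeasurableSpace Ω] {S : SwitchedSystem N n Ω}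
  {P : Measure Ω}

/-- The second inequality comes from running the flow backwards, hence the use of exponential bounds
for `|s| ≤ T`. -/
theorem IsBounded.exists_flow_bounds (hb : S.IsBounded P) :
    ∃ T > (0 : ℝ), ∃ M > (0 : ℝ), (∀ i k, ∀ᵐ ω ∂P, S.dwell i k ω ≤ T) ∧
      ∀ l, ∀ s : ℝ, 0 ≤ s → s ≤ T → ∀ x : EuclideanSpace ℝ (Fin n),
        ‖NormedSpace.exp (s • S.modeCLM l) x‖ₑ ≤ ENNReal.ofReal M * ‖x‖ₑ ∧
          ‖x‖ₑ ≤ ENNReal.ofReal M * ‖NormedSpace.exp (s • S.modeCLM l) x‖ₑ := by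
  obtain ⟨T, hT, hd⟩ := hb.dwell_le
  obtain ⟨M, hM, hexp⟩ := exists_norm_exp_smul_le S.modeCLM T
  have key : ∀ l, ∀ s : ℝ, |s| ≤ T → ∀ x : EuclideanSpace ℝ (Fin n),
      ‖NormedSpace.exp (s • S.modeCLM l) x‖ₑ ≤ ENNReal.ofReal M * ‖x‖ₑ := by
    intro l s hs x
    rw [← ofReal_norm, ← ofReal_norm, ← ENNReal.ofReal_mul hM.le]
    exact ENNReal.ofReal_le_ofReal (ContinuousLinearMap.le_of_opNorm_le _ (hexp l s hs) x)
  refine ⟨T, hT, M, hM, hd, fun l s h0 hs x => ⟨key l s (by rwa [abs_of_nonneg h0]) x, ?_⟩⟩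
  conv_lhs => rw [← exp_neg_smul_apply (S.modeCLM l) s x]
  exact key l (-s) (by rwa [abs_neg, abs_of_nonneg h0]) _

theorem ae_time_le {T : ℝ} (hd : ∀ i k, ∀ᵐ ω ∂P, S.dwell i k ω ≤ T) (i : Fin N) :
    ∀ᵐ ω ∂P, ∀ k : ℕ, S.time i k ω ≤ k * T := by
  filter_upwards [ae_all_iff.mpr (hd i)] with ω hω k
  induction k with
  | zero => simp [S.time_zero]
  | succ k ih =>
    rw [time_succ]
    push_cast
    linarith [hω k]

theorem exists_mem_Ico_time {i : Fin N} {ω : Ω} {t : ℝ} (ht : 0 ≤ t)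
    (h : ∃ k, t < S.time i k ω) : ∃ k, t ∈ Ico (S.time i k ω) (S.time i (k + 1) ω) := by
  classical
  have hs := Nat.find_spec h
  have h0 : Nat.find h ≠ 0 := fun h0 => by
    rw [h0, S.time_zero] at hs
    linarith
  obtain ⟨k, hk⟩ := Nat.exists_eq_succ_of_ne_zero h0
  refine ⟨k, not_lt.mp (Nat.find_min h (by omega)), ?_⟩
  rwa [hk] at hs

variable [IsProbabilityMeasure P]

theorem isExpMeanStable_of_discretization (hS : S.IsSemiMarkov P) (hb : S.IsBounded P) (m : ℕ)
    (h : S.discretization.IsExpMeanStable P m) : S.IsExpMeanStable P m := by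
  obtain ⟨T, hT, M, hM, hd, hflow⟩ := hb.exists_flow_bounds
  obtain ⟨C, hC, β, hβ, hstab⟩ := h
  have hq : Summable fun k : ℕ => Real.exp (-(β / 2) * k) := by
    have := Real.summable_exp_nat_mul_iff.mpr (show -(β / 2) < 0 by linarith)
    simpa [mul_comm] using this
  have hG : 0 < ∑' k : ℕ, Real.exp (-(β / 2) * k) :=
    hq.tsum_pos (fun _ => (Real.exp_pos _).le) 0 (Real.exp_pos _)
  -- The rate `β` is split: one half makes the series in `k` converge, the other becomes decay in
  -- `t` through `t < (k+1)T`, with `exp (β/2)` paying for the `+1`.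
  refine ⟨M ^ m * C * Real.exp (β / 2) * ∑' k : ℕ, Real.exp (-(β / 2) * k), by positivity,
    β / (2 * T), by positivity, fun i x₀ x hx t ht => ?_⟩
  -- The random index of the interval containing `t` is absorbed by summing over every possible `k`.
  -- The bound is measurable even if `x t` is not.
  have hpt : ∀ᵐ ω ∂P, ‖x t ω‖ₑ ^ m ≤ ∑' k : ℕ, if t < (k + 1) * T then
      ENNReal.ofReal M ^ m * ‖S.discretization.trajectory i x₀ k ω‖ₑ ^ m else 0 := by
    filter_upwards [hx.ae_eq S hb.dwell_pos, ae_time_le hd i, ae_all_iff.mpr (hd i),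
      ae_exists_lt_time hS (fun l => hb.dwell_pos l 0) i t] with ω hω hle hdw hex
    obtain ⟨k, hk⟩ := exists_mem_Ico_time ht hex
    refine le_trans ?_ (ENNReal.le_tsum k)
    have hkT := hle (k + 1)
    push_cast at hkT
    rw [if_pos (hk.2.trans_le hkT), hω k t hk, ← mul_pow]
    gcongr
    have := hdw k
    have := hk.2
    exact (hflow _ _ (sub_nonneg.mpr hk.1) (by unfold dwell at *; linarith) _).1
  have hterm : ∀ k : ℕ, ∫⁻ ω, (if t < (k + 1) * T then
      ENNReal.ofReal M ^ m * ‖S.discretization.trajectory i x₀ k ω‖ₑ ^ m else 0) ∂P ≤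
      ENNReal.ofReal (M ^ m * C * Real.exp (β / 2) * Real.exp (-(β / (2 * T)) * t) * ‖x₀‖ ^ m *
        Real.exp (-(β / 2) * k)) := by
    intro k
    split_ifs with hk
    · rw [lintegral_const_mul' _ _ (ENNReal.pow_ne_top ENNReal.ofReal_ne_top)]
      refine (mul_le_mul_right (hstab i x₀ k) _).trans ?_
      rw [← ENNReal.ofReal_pow hM.le, ← ENNReal.ofReal_mul (by positivity)]
      apply ENNReal.ofReal_le_ofReal
      have he : Real.exp (-β * k) ≤ Real.exp (β / 2) * Real.exp (-(β / (2 * T)) * t) *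
          Real.exp (-(β / 2) * k) := by
        rw [← Real.exp_add, ← Real.exp_add, Real.exp_le_exp]
        have h1 : β / (2 * T) * t ≤ β / 2 * (k + 1) := by
          rw [div_mul_eq_mul_div, div_le_iff₀ (by positivity)]
          nlinarith
        linarith
      calc M ^ m * (C * Real.exp (-β * k) * ‖x₀‖ ^ m)
          ≤ M ^ m * (C * (Real.exp (β / 2) * Real.exp (-(β / (2 * T)) * t) *
            Real.exp (-(β / 2) * k)) * ‖x₀‖ ^ m) := by gcongr
        _ = _ := by ring
    · simp
  calc ∫⁻ ω, ‖x t ω‖ₑ ^ m ∂P ≤ ∫⁻ ω, ∑' k : ℕ, (if t < (k + 1) * T then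
        ENNReal.ofReal M ^ m * ‖S.discretization.trajectory i x₀ k ω‖ₑ ^ m else 0) ∂P :=
        lintegral_mono_ae hpt
    _ = ∑' k : ℕ, ∫⁻ ω, (if t < (k + 1) * T then
        ENNReal.ofReal M ^ m * ‖S.discretization.trajectory i x₀ k ω‖ₑ ^ m else 0) ∂P := by
        refine lintegral_tsum fun k => Measurable.aemeasurable ?_
        split_ifs
        · exact ((S.measurable_trajectory i x₀ k).enorm.pow_const m).const_mul _
        · exact measurable_const
    _ ≤ ∑' k : ℕ, ENNReal.ofReal (M ^ m * C * Real.exp (β / 2) *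
        Real.exp (-(β / (2 * T)) * t) * ‖x₀‖ ^ m * Real.exp (-(β / 2) * k)) :=
        ENNReal.tsum_le_tsum hterm
    _ = _ := by
        rw [← ENNReal.ofReal_tsum_of_nonneg (fun _ => by positivity) (hq.mul_left _), tsum_mul_left]
        congr 1
        ring

/-- The sum of the moments of the discretization, from exponential mean stability of the
continuous-time system. -/
theorem exists_tsum_lintegral_trajectory_le (hS : S.IsSemiMarkov P) (hb : S.IsBounded P) (m : ℕ)
    (h : S.IsExpMeanStable P m) :
    ∃ K : ℝ≥0∞, K ≠ ⊤ ∧ ∀ i (x₀ : EuclideanSpace ℝ (Fin n)),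
      ∑' k, ∫⁻ ω, ‖S.discretization.trajectory i x₀ k ω‖ₑ ^ m ∂P ≤ K * ‖x₀‖ₑ ^ m := by
  obtain ⟨T, hT, M, hM, hd, hflow⟩ := hb.exists_flow_bounds
  obtain ⟨C, hC, β, hβ, hstab⟩ := h
  obtain ⟨δ, hδ0, hδt, hδ⟩ := exists_le_lintegral_dwell fun l => hb.dwell_pos l 0
  set I : ℝ≥0∞ := ∫⁻ t in Ioi (0 : ℝ), ENNReal.ofReal (Real.exp (-β * t)) with hI
  have hIt : I ≠ ⊤ := (exp_neg_integrableOn_Ioi 0 hβ).lintegral_lt_top.ne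
  have hMt : ENNReal.ofReal M ^ m ≠ ⊤ := ENNReal.pow_ne_top ENNReal.ofReal_ne_top
  refine ⟨δ⁻¹ * (ENNReal.ofReal M ^ m * (ENNReal.ofReal C * I)),
    ENNReal.mul_ne_top (ENNReal.inv_ne_top.mpr hδ0)
      (ENNReal.mul_ne_top hMt (ENNReal.mul_ne_top ENNReal.ofReal_ne_top hIt)), fun i x₀ => ?_⟩
  let f : ℕ → Ω → ℝ≥0∞ := fun k ω => ‖S.discretization.trajectory i x₀ k ω‖ₑ ^ m
  have hf : ∀ k, Measurable[S.history i k] (f k) := fun k =>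
    (measurable_enorm.pow_const m).comp (S.measurable_trajectory_history i x₀ k)
  have hf' : ∀ k, Measurable (f k) := fun k => (hf k).mono (S.history_le i k) le_rfl
  -- Integrating `g k` over `t` gives `f k` times the dwell time, while at fixed `t` at most one `g
  -- k` is nonzero.
  let g : ℕ → ℝ → Ω → ℝ≥0∞ := fun k t ω =>
    (Ico (S.time i k ω) (S.time i (k + 1) ω)).indicator (fun _ => f k ω) t
  have hg : ∀ k, Measurable fun q : Ω × ℝ => g k q.2 q.1 := by
    intro k
    have hs : MeasurableSet {q : Ω × ℝ | q.2 ∈ Ico (S.time i k q.1) (S.time i (k + 1) q.1)} :=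
      (measurableSet_le ((S.measurable_time i k).comp measurable_fst) measurable_snd).inter
        (measurableSet_lt measurable_snd ((S.measurable_time i (k + 1)).comp measurable_fst))
    exact ((hf' k).comp measurable_fst).indicator hs
  have hg' : ∀ k t, Measurable (g k t) := fun k t => (hg k).comp measurable_prodMk_right
  have hpt : ∀ t, ∀ᵐ ω ∂P, ∑' k, g k t ω ≤ ENNReal.ofReal M ^ m * ‖S.solution i x₀ t ω‖ₑ ^ m := by
    intro t
    filter_upwards [ae_all_iff.mpr (hd i)] with ω hdw
    by_cases hex : ∃ k, t ∈ Ico (S.time i k ω) (S.time i (k + 1) ω)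
    · obtain ⟨k, hk⟩ := hex
      rw [tsum_eq_single k fun l hl =>
        indicator_of_notMem (fun hmem => hl (eq_of_mem_Ico_time hmem hk)) _]
      simp only [f, indicator_of_mem hk]
      rw [solution_eq i x₀ hk, ← mul_pow]
      gcongr
      have := hdw k
      have := hk.2
      exact (hflow _ _ (sub_nonneg.mpr hk.1) (by unfold dwell at *; linarith) _).2
    · have hz : ∀ k, g k t ω = 0 := fun k => indicator_of_notMem (fun hk => hex ⟨k, hk⟩) _
      simp [hz]
  have hslice : ∀ t ∈ Ioi (0 : ℝ), ∑' k, ∫⁻ ω, g k t ω ∂P ≤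
      ENNReal.ofReal M ^ m * (ENNReal.ofReal C * ‖x₀‖ₑ ^ m) *
        ENNReal.ofReal (Real.exp (-β * t)) := by
    intro t ht
    rw [← lintegral_tsum fun k => (hg' k t).aemeasurable]
    refine (lintegral_mono_ae (hpt t)).trans ?_
    rw [lintegral_const_mul' _ _ hMt, mul_assoc]
    gcongr
    refine (hstab i x₀ _ (isTrajectory_solution hb.dwell_pos i x₀) t (le_of_lt ht)).trans_eq ?_
    rw [ENNReal.ofReal_mul (by positivity), ENNReal.ofReal_mul hC.le,
      ENNReal.ofReal_pow (norm_nonneg _), ofReal_norm]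
    ring
  -- Tonelli: integrating in `t` first yields the length of the interval.
  have harea : ∀ k, ∫⁻ t in Ioi (0 : ℝ), ∫⁻ ω, g k t ω ∂P =
      ∫⁻ ω, f k ω * ENNReal.ofReal (S.dwell i k ω) ∂P := by
    intro k
    rw [lintegral_lintegral_swap ((hg k).comp measurable_swap).aemeasurable]
    refine lintegral_congr fun ω => ?_
    have h0 : 0 ≤ S.time i k ω := by
      rw [← S.time_zero i ω]
      exact S.time_mono i ω k.zero_le
    rw [setLIntegral_congr Ioi_ae_eq_Ici, lintegral_indicator measurableSet_Ico,
      Measure.restrict_restrict measurableSet_Ico,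
      inter_eq_left.mpr (Ico_subset_Ici_self.trans (Ici_subset_Ici.mpr h0)), setLIntegral_const, Real.volume_Ico]
    rfl
  -- `f k` depends only on the past, so `h_k` can be replaced by its mean given `σ_k`, which is at
  -- least `δ`.
  have hlower : ∀ k, δ * ∫⁻ ω, f k ω ∂P ≤ ∫⁻ ω, f k ω * ENNReal.ofReal (S.dwell i k ω) ∂P := by
    intro k
    rw [lintegral_mul_dwell hS i k (hf k) ENNReal.measurable_ofReal, ← lintegral_const_mul' _ _ hδt]
    refine lintegral_mono fun ω => ?_
    simp only [mul_comm δ]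
    gcongr
    exact hδ _
  have hsum : δ * ∑' k, ∫⁻ ω, f k ω ∂P ≤
      ENNReal.ofReal M ^ m * (ENNReal.ofReal C * ‖x₀‖ₑ ^ m) * I := by
    rw [← ENNReal.tsum_mul_left]
    calc ∑' k, δ * ∫⁻ ω, f k ω ∂P ≤ ∑' k, ∫⁻ t in Ioi (0 : ℝ), ∫⁻ ω, g k t ω ∂P :=
          ENNReal.tsum_le_tsum fun k => (hlower k).trans_eq (harea k).symm
      _ = ∫⁻ t in Ioi (0 : ℝ), ∑' k, ∫⁻ ω, g k t ω ∂P :=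
          (lintegral_tsum fun k =>
            ((hg k).comp measurable_swap).lintegral_prod_right'.aemeasurable).symm
      _ ≤ ∫⁻ t in Ioi (0 : ℝ), ENNReal.ofReal M ^ m * (ENNReal.ofReal C * ‖x₀‖ₑ ^ m) *
            ENNReal.ofReal (Real.exp (-β * t)) := setLIntegral_mono' measurableSet_Ioi hslice
      _ = _ := lintegral_const_mul _ (by fun_prop)
  calc ∑' k, ∫⁻ ω, f k ω ∂P = δ⁻¹ * (δ * ∑' k, ∫⁻ ω, f k ω ∂P) := by
        rw [← mul_assoc, ENNReal.inv_mul_cancel hδ0 hδt, one_mul]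
    _ ≤ δ⁻¹ * (ENNReal.ofReal M ^ m * (ENNReal.ofReal C * ‖x₀‖ₑ ^ m) * I) := by gcongr
    _ = _ := by ring

theorem discretization_isExpMeanStable (hS : S.IsSemiMarkov P) (hb : S.IsBounded P) (m : ℕ)
    (h : S.IsExpMeanStable P m) : S.discretization.IsExpMeanStable P m := by
  obtain ⟨K', hK't, hK'⟩ := exists_tsum_lintegral_trajectory_le hS hb m h
  -- Enlarging the constant to at least `2` puts `1 - 1/K` strictly between `0` and `1`, so that `β
  -- = -log (1 - 1/K)` is positive and `e^{-βk} = (1 - 1/K)^k`.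
  set K : ℝ := max 2 K'.toReal with hKdef
  have hK2 : 2 ≤ K := le_max_left _ _
  have hKpos : 0 < K := by linarith
  have hKinv : K⁻¹ < 1 := inv_lt_one_of_one_lt₀ (by linarith)
  have hKinv0 : 0 < K⁻¹ := inv_pos.mpr hKpos
  have hle : K' ≤ ENNReal.ofReal K := by
    rw [← ENNReal.ofReal_toReal hK't]
    exact ENNReal.ofReal_le_ofReal (le_max_right _ _)
  let φ : Fin N × EuclideanSpace ℝ (Fin n) → ℝ≥0∞ := fun p => ‖p.2‖ₑ ^ m
  have hφ : Measurable φ := measurable_snd.enorm.pow_const m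
  have hmom : ∀ i x₀ k, ∫⁻ ω, ‖S.discretization.trajectory i x₀ k ω‖ₑ ^ m ∂P =
      (S.meanStep P)^[k] φ (i, x₀) := fun i x₀ k => lintegral_trajectory hS i x₀ k hφ
  have hgeo := meanStep_iterate_le (S := S) (P := P) hφ
    (fun p => ENNReal.pow_ne_top enorm_ne_top) ENNReal.ofReal_ne_top (fun p => by
      simp only [← hmom]
      exact (hK' p.1 p.2).trans (by gcongr))
  refine ⟨K, hKpos, -Real.log (1 - K⁻¹), neg_pos.mpr (Real.log_neg (by linarith) (by linarith)),
    fun i x₀ k => ?_⟩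
  rw [hmom]
  refine (hgeo k (i, x₀)).trans_eq ?_
  rw [neg_neg, mul_comm (Real.log _), Real.exp_nat_mul, Real.exp_log (by linarith),
    ENNReal.ofReal_mul (by have := pow_pos (sub_pos.mpr hKinv) k; positivity),
    ENNReal.ofReal_mul hKpos.le, ENNReal.ofReal_pow (by linarith),
    ENNReal.ofReal_pow (norm_nonneg _), ofReal_norm, ENNReal.ofReal_sub _ hKinv0.le,
    ENNReal.ofReal_one, ENNReal.ofReal_inv_of_pos hKpos]

end Stability

end SwitchedSystem

end

theorem corollary4p7 {N n : ℕ} {Ω : Type*} [MeasurableSpace Ω]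
    (P : Measure Ω) [IsProbabilityMeasure P] (S : SwitchedSystem N n Ω)
    (hS : S.IsSemiMarkov P) (hpos : S.IsPositive P) (hbdd : S.IsBounded P)
    (m : ℕ) (hm : 0 < m) :
    S.IsExpMeanStable P m ↔ S.discretization.IsExpMeanStable P m :=
  ⟨SwitchedSystem.discretization_isExpMeanStable hS hbdd m,
    SwitchedSystem.isExpMeanStable_of_discretization hS hbdd m⟩
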